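/- Let $X$ be a (connected) Riemann surface. A holomorphic vector bundle $V$ of rank $n$ on $X$ is *projectively flat* if it admits trivialisations over an open cover $\{U_i\}$ whose transition functions have the form $\lambda_{ij}T_{ij}$ with $\lambda_{ij}:U_i\cap U_j\to\mathbb{C}^\times$ holomorphic and $T_{ij}\in GL_n(\mathbb{C})$ constant. For a meromorphic section $A$ of $V$, written $A=(a_1,\dots,a_n)$ in a trivialisation and a local coordinate, let $w(A)=\det\big(a_k^{(j)}\big)_{0\le j<n,\,1\le k\le n}$ be its Wronskian; $A$ is *generic* (with respect to given projectively flat trivialisations) if $w(A)\not\equiv 0$, and then the divisor $\operatorname{div}(A)$ of $w(A)$, computed in projectively flat trivialisations, does not depend on the local coordinates. The *Wronskian line bundle* $w(V)$ is the line bundle $\mathcal{O}(\operatorname{div}(A))$, up to isomorphism, for any generic meromorphic section $A$ of $V$. **Lemma.** Let $V$ be a projectively flat bundle of rank $n$ on $X$ and let $L$ be a holomorphic line bundle on $X$. Then $V\otimes L$ is projectively flat and $$w(V\otimes L)\;\cong\; w(V)\otimes L^{\otimes n}.$$ That is: if $M$ is the Wronskian line bundle of $V$, computed from any projectively flat trivialisations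 of $V$ and any generic section of $V$, and $N$ is the Wronskian line bundle of $V\otimes L$, computed from any projectively flat trivialisations of $V\otimes L$ and any generic section of $V\otimes L$, then $N\cong M\otimes L^{\otimes n}$; and if $V$ has a generic meromorphic section and $L$ has a meromorphic section that is not identically zero, then $M\otimes L^{\otimes n}$ is a Wronskian line bundle of $V\otimes L$. Moreover, for meromorphic sections $A$ of $V$ and $f$ of $L$, in all local coordinates and trivialisations, $w(fA)=f^n\,w(A)$ as meromorphic functions. -/

import Mathlib

open Set Filter Topology
open scoped Manifold ContDiff

universe u

noncomputable section

/-! ### Holomorphic vector bundles on a Riemann surface -/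

/-- A holomorphic vector bundle on `X` with standard fibre `F`, given by an open cover and
holomorphic transition functions.  Here `core.coordChange i j x` carries the coordinates of a vector
in the `i`-th frame to its coordinates in the `j`-th frame. -/
structure HolBundle (X : Type u) [TopologicalSpace X] [ChartedSpace ℂ X]
    (F : Type*) [NormedAddCommGroup F] [NormedSpace ℂ F] where
  {ι : Type u}
  core : VectorBundleCore ℂ X F ι
  holomorphic : core.IsContMDiff 𝓘(ℂ) ω

/-- Holomorphic line bundles. -/
abbrev LineBundle (X : Type u) [TopologicalSpace X] [ChartedSpace ℂ X] := HolBundle X ℂ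

namespace HolBundle

variable {X : Type u} [TopologicalSpace X] [ChartedSpace ℂ X]
  {F : Type*} [NormedAddCommGroup F] [NormedSpace ℂ F]

/-- Isomorphism of holomorphic vector bundles: in the frames `i` of `V` and `k` of `W`, the
isomorphism is a holomorphic family `g i k` of invertible linear maps, and these local expressions
are compatible with the transition functions of `V` and `W`. -/
def Iso (V W : HolBundle X F) : Prop :=
  ∃ g : V.ι → W.ι → X → (F →L[ℂ] F),
    (∀ i k, ContMDiffOn 𝓘(ℂ) 𝓘(ℂ, F →L[ℂ] F) ω (g i k)
      (V.core.baseSet i ∩ W.core.baseSet k)) ∧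
    (∀ i k, ∀ x ∈ V.core.baseSet i ∩ W.core.baseSet k, IsUnit (g i k x)) ∧
    (∀ i j k l, ∀ x ∈ (V.core.baseSet i ∩ V.core.baseSet j) ∩
        (W.core.baseSet k ∩ W.core.baseSet l), ∀ v : F,
      W.core.coordChange k l x (g i k x v) = g j l x (V.core.coordChange i j x v))

/-- The scalar transition functions of a line bundle. -/
def trans (L : LineBundle X) (k l : L.ι) (x : X) : ℂ := L.core.coordChange k l x 1

lemma trans_self (L : LineBundle X) (k : L.ι) {x : X} (hx : x ∈ L.core.baseSet k) :
    L.trans k k x = 1 := L.core.coordChange_self k x hx 1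

lemma trans_comp (L : LineBundle X) (i j k : L.ι) {x : X}
    (hx : x ∈ L.core.baseSet i ∩ L.core.baseSet j ∩ L.core.baseSet k) :
    L.trans j k x * L.trans i j x = L.trans i k x := by
  have h := L.core.coordChange_comp i j k x hx 1
  have h2 : L.core.coordChange j k x (L.core.coordChange i j x 1)
      = L.core.coordChange i j x 1 * L.core.coordChange j k x 1 := by
    conv_lhs => rw [← mul_one (L.core.coordChange i j x 1), ← smul_eq_mul, map_smul, smul_eq_mul]
  unfold trans
  rw [← h, h2, mul_comm]

lemma contMDiffOn_trans (L : LineBundle X) (k l : L.ι) :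
    ContMDiffOn 𝓘(ℂ) 𝓘(ℂ) ω (L.trans k l) (L.core.baseSet k ∩ L.core.baseSet l) :=
  ((ContinuousLinearMap.apply ℂ ℂ (1 : ℂ)).contMDiff).comp_contMDiffOn
    (L.holomorphic.contMDiffOn_coordChange k l)

/-- The tensor product of a vector bundle with a line bundle: on the intersections of the two covers
the transition functions are the products of those of the factors. -/
def tensor (V : HolBundle X F) (L : LineBundle X) : HolBundle X F where
  ι := V.ι × L.ι
  core :=
    { baseSet := fun p => V.core.baseSet p.1 ∩ L.core.baseSet p.2
      isOpen_baseSet := fun p =>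
        (V.core.isOpen_baseSet p.1).inter (L.core.isOpen_baseSet p.2)
      indexAt := fun x => (V.core.indexAt x, L.core.indexAt x)
      mem_baseSet_at := fun x => ⟨V.core.mem_baseSet_at x, L.core.mem_baseSet_at x⟩
      coordChange := fun p q x => L.trans p.2 q.2 x • V.core.coordChange p.1 q.1 x
      coordChange_self := fun p x hx v => by
        simp [L.trans_self p.2 hx.2, V.core.coordChange_self p.1 x hx.1]
      continuousOn_coordChange := fun p q =>
        ((L.contMDiffOn_trans p.2 q.2).continuousOn.mono fun _ hx => ⟨hx.1.2, hx.2.2⟩).smul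
          ((V.core.continuousOn_coordChange p.1 q.1).mono fun _ hx => ⟨hx.1.1, hx.2.1⟩)
      coordChange_comp := fun p q r x hx v => by
        simp only [smul_apply, map_smul]
        rw [V.core.coordChange_comp p.1 q.1 r.1 x ⟨⟨hx.1.1.1, hx.1.2.1⟩, hx.2.1⟩, smul_smul,
          ← L.trans_comp p.2 q.2 r.2 ⟨⟨hx.1.1.2, hx.1.2.2⟩, hx.2.2⟩, mul_comm] }
  holomorphic := ⟨fun p q =>
    ((L.contMDiffOn_trans p.2 q.2).mono fun _ hx => ⟨hx.1.2, hx.2.2⟩).smul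
      ((V.holomorphic.contMDiffOn_coordChange p.1 q.1).mono fun _ hx => ⟨hx.1.1, hx.2.1⟩)⟩

/-- The `n`-th tensor power of a line bundle: the transition functions are raised to the `n`-th
power. -/
def pow (L : LineBundle X) (n : ℕ) : LineBundle X where
  ι := L.ι
  core :=
    { baseSet := L.core.baseSet
      isOpen_baseSet := L.core.isOpen_baseSet
      indexAt := L.core.indexAt
      mem_baseSet_at := L.core.mem_baseSet_at
      coordChange := fun k l x => L.trans k l x ^ n • ContinuousLinearMap.id ℂ ℂ
      coordChange_self := fun k x hx v => by simp [L.trans_self k hx]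
      continuousOn_coordChange := fun k l =>
        ((L.contMDiffOn_trans k l).continuousOn.pow n).smul continuousOn_const
      coordChange_comp := fun i j k x hx v => by
        simp only [smul_apply, ContinuousLinearMap.id_apply, smul_eq_mul]
        rw [← L.trans_comp i j k hx, mul_pow, mul_assoc] }
  holomorphic := ⟨fun k l => ((L.contMDiffOn_trans k l).pow n).smul contMDiffOn_const⟩

/-! ### Projectively flat bundles -/

/-- The given trivialisations are projectively flat: every transition function is a nowhere
vanishing holomorphic function times a constant invertible matrix. -/
def HasPFTransitions {n : ℕ} (V : HolBundle X (Fin n → ℂ)) : Prop :=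
  ∀ i j, ∃ (lam : X → ℂ) (T : GL (Fin n) ℂ),
    ContMDiffOn 𝓘(ℂ) 𝓘(ℂ) ω lam (V.core.baseSet i ∩ V.core.baseSet j) ∧
    ∀ x ∈ V.core.baseSet i ∩ V.core.baseSet j, lam x ≠ 0 ∧
      ∀ v, V.core.coordChange i j x v = lam x • (T : Matrix (Fin n) (Fin n) ℂ).mulVec v

/-- A holomorphic vector bundle is projectively flat if it can be described by trivialisations with
projectively flat transition functions. -/
def IsProjectivelyFlat {n : ℕ} (V : HolBundle X (Fin n → ℂ)) : Prop :=
  ∃ Z : HolBundle X (Fin n → ℂ), Z.HasPFTransitions ∧ Z.Iso V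

/-! ### Meromorphic sections -/

/-- A meromorphic section, given by its local expressions `loc i` in the frames of `V`.  As usual
for Mathlib's meromorphic functions, the values at the poles carry no meaning. -/
structure MeromorphicSection (V : HolBundle X F) where
  loc : V.ι → X → F
  compat : ∀ i j, ∀ x ∈ V.core.baseSet i ∩ V.core.baseSet j,
    loc j x = V.core.coordChange i j x (loc i x)
  meromorphic : ∀ i, ∀ x ∈ V.core.baseSet i,
    MeromorphicAt (loc i ∘ (chartAt ℂ x).symm) (chartAt ℂ x x)

/-- The section `f A` of `V ⊗ L`, for a section `A` of `V` and a section `f` of `L`. -/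
def MeromorphicSection.mul {V : HolBundle X F} {L : LineBundle X}
    (f : L.MeromorphicSection) (A : V.MeromorphicSection) :
    (V.tensor L).MeromorphicSection where
  loc := fun p x => f.loc p.2 x • A.loc p.1 x
  compat := fun p q x hx => by
    have hL : f.loc q.2 x = f.loc p.2 x * L.trans p.2 q.2 x := by
      rw [f.compat p.2 q.2 x ⟨hx.1.2, hx.2.2⟩]
      conv_lhs => rw [← mul_one (f.loc p.2 x), ← smul_eq_mul, map_smul, smul_eq_mul]
      rfl
    have hA := A.compat p.1 q.1 x ⟨hx.1.1, hx.2.1⟩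
    simp only [tensor, smul_apply, map_smul, hL, hA, smul_smul]
  meromorphic := fun p x hx =>
    (f.meromorphic p.2 x hx.2).smul (A.meromorphic p.1 x hx.1)

/-- A meromorphic section of a line bundle that does not vanish identically. -/
def MeromorphicSection.IsNonzero {L : LineBundle X} (f : L.MeromorphicSection) : Prop :=
  ∃ x : X, meromorphicOrderAt (f.loc (L.core.indexAt x) ∘ (chartAt ℂ x).symm) (chartAt ℂ x x) ≠ ⊤

end HolBundle

/-! ### Wronskians -/

/-- The Wronskian determinant of a map `a = (a₁, …, aₙ)`: the `j`-th row (`j = 0, …, n - 1`)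
consists of the `j`-th derivatives of the components. -/
def wronskian {n : ℕ} (a : ℂ → Fin n → ℂ) (z : ℂ) : ℂ :=
  (Matrix.of fun j k : Fin n => iteratedDeriv (j : ℕ) (fun t => a t k) z).det

namespace HolBundle

variable {X : Type u} [TopologicalSpace X] [ChartedSpace ℂ X]

namespace MeromorphicSection

variable {n : ℕ} {V : HolBundle X (Fin n → ℂ)}

/-- The Wronskian `w(A)` in the local coordinate `e` and the `i`-th frame. -/
def wronskianIn (A : V.MeromorphicSection) (e : OpenPartialHomeomorph X ℂ) (i : V.ι) : ℂ → ℂ :=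
  wronskian (A.loc i ∘ e.symm)

/-- The order at `x` of `w(A)`.  If the frames of `V` are projectively flat, it does not depend on
the local coordinate or the frame around `x` used to compute it. -/
def wronskianOrder (A : V.MeromorphicSection) (x : X) : WithTop ℤ :=
  meromorphicOrderAt (A.wronskianIn (chartAt ℂ x) (V.core.indexAt x)) (chartAt ℂ x x)

/-- `A` is generic: its Wronskian does not vanish identically. -/
def IsGeneric (A : V.MeromorphicSection) : Prop := ∃ x : X, A.wronskianOrder x ≠ ⊤

open Classical in
/-- The divisor `div(A)` of the Wronskian of `A`.  For generic `A`, projectively flat frames and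
connected `X`, the orders are always finite, and nonzero only at a locally finite set of points; in
the other cases the value `0` is irrelevant. -/
def wronskianDivisor (A : V.MeromorphicSection) : Function.locallyFinsupp X ℤ :=
  if h : ∀ z : X, ∃ t ∈ 𝓝 z, (t ∩ Function.support fun x => (A.wronskianOrder x).untop₀).Finite
  then ⟨fun x => (A.wronskianOrder x).untop₀, subset_univ _, fun z _ => h z⟩
  else 0

end MeromorphicSection

end HolBundle

/-! ### The line bundle of a divisor -/

section Divisor

variable {X : Type u} [TopologicalSpace X] [ChartedSpace ℂ X]

/-- A neighbourhood of `p`, inside a coordinate chart, without points of the support of `D` other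
than possibly `p`. -/
def divisorNhd (D : Function.locallyFinsupp X ℤ) (p : X) : Set X :=
  (chartAt ℂ p).source ∩ interior {y | y = p ∨ D y = 0}

/-- The local equation `(z - z(p)) ^ D(p)` of `D` near `p`, where `z` is a coordinate at `p`. -/
def divisorEq (D : Function.locallyFinsupp X ℤ) (p y : X) : ℂ :=
  (chartAt ℂ p y - chartAt ℂ p p) ^ D p

lemma mem_divisorNhd [T1Space X] (D : Function.locallyFinsupp X ℤ) (p : X) :
    p ∈ divisorNhd D p := by
  refine ⟨mem_chart_source ℂ p, mem_interior_iff_mem_nhds.2 ?_⟩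
  obtain ⟨t, ht, hfin⟩ := D.supportLocallyFiniteWithinDomain' p (mem_univ p)
  have hc : ((t ∩ Function.support D) \ {p})ᶜ ∈ 𝓝 p :=
    (hfin.sdiff).isClosed.isOpen_compl.mem_nhds (by simp)
  filter_upwards [ht, hc] with y hy hy'
  by_contra hcon
  simp only [not_or] at hcon
  exact hy' ⟨⟨hy, hcon.2⟩, hcon.1⟩

lemma divisorNhd_or {D : Function.locallyFinsupp X ℤ} {p q y : X} (hpq : p ≠ q)
    (hp : y ∈ divisorNhd D p) (hq : y ∈ divisorNhd D q) :
    D p = 0 ∨ chartAt ℂ p y - chartAt ℂ p p ≠ 0 := by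
  by_cases h : y = p
  · subst h
    left
    rcases interior_subset hq.2 with h | h
    · exact absurd h hpq
    · exact h
  · right
    intro h0
    exact h ((chartAt ℂ p).injOn hp.1 (mem_chart_source ℂ p) (sub_eq_zero.1 h0))

lemma divisorEq_ne_zero {D : Function.locallyFinsupp X ℤ} {p q y : X} (hpq : p ≠ q)
    (hp : y ∈ divisorNhd D p) (hq : y ∈ divisorNhd D q) : divisorEq D p y ≠ 0 := by
  rcases divisorNhd_or hpq hp hq with h | h
  · simp [divisorEq, h]
  · exact zpow_ne_zero _ h

lemma contMDiffOn_divisorEq [IsManifold 𝓘(ℂ) ω X] (D : Function.locallyFinsupp X ℤ) {p q : X}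
    (hpq : p ≠ q) : ContMDiffOn 𝓘(ℂ) 𝓘(ℂ) ω (divisorEq D p)
      (divisorNhd D p ∩ divisorNhd D q) := by
  intro y hy
  by_cases h0 : D p = 0
  · have : divisorEq D p = fun _ => (1 : ℂ) := by
      funext y; simp [divisorEq, h0]
    rw [this]
    exact contMDiffWithinAt_const
  have hne := (divisorNhd_or hpq hy.1 hy.2).resolve_left h0
  have hz : ContDiffAt ℂ ω (fun w : ℂ => (w - chartAt ℂ p p) ^ D p) (chartAt ℂ p y) :=
    ((analyticAt_id.sub analyticAt_const).fun_zpow hne).contDiffAt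
  have hchart : ContMDiffAt 𝓘(ℂ) 𝓘(ℂ) ω (chartAt ℂ p) y :=
    contMDiffAt_of_mem_maximalAtlas (IsManifold.chart_mem_maximalAtlas p) hy.1.1
  exact (hz.comp_contMDiffAt hchart).contMDiffWithinAt

open Classical in
/-- The transition functions of `𝒪(D)`: quotients of local equations. -/
def divisorTrans (D : Function.locallyFinsupp X ℤ) (p q y : X) : ℂ :=
  if p = q then 1 else divisorEq D q y / divisorEq D p y

lemma contMDiffOn_divisorTrans [IsManifold 𝓘(ℂ) ω X] (D : Function.locallyFinsupp X ℤ) (p q : X) :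
    ContMDiffOn 𝓘(ℂ) 𝓘(ℂ) ω (divisorTrans D p q) (divisorNhd D p ∩ divisorNhd D q) := by
  by_cases hpq : p = q
  · have : divisorTrans D p q = fun _ => (1 : ℂ) := by
      funext y; simp [divisorTrans, hpq]
    rw [this]
    exact contMDiffOn_const
  · have : divisorTrans D p q = fun y => divisorEq D q y / divisorEq D p y := by
      funext y; simp [divisorTrans, hpq]
    rw [this]
    exact ((contMDiffOn_divisorEq D (Ne.symm hpq)).mono fun _ h => ⟨h.2, h.1⟩).div₀
      (contMDiffOn_divisorEq D hpq) fun y hy => divisorEq_ne_zero hpq hy.1 hy.2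

lemma divisorTrans_comp (D : Function.locallyFinsupp X ℤ) (p q r : X) {y : X}
    (hy : y ∈ divisorNhd D p ∩ divisorNhd D q ∩ divisorNhd D r) :
    divisorTrans D q r y * divisorTrans D p q y = divisorTrans D p r y := by
  obtain ⟨⟨hp, hq⟩, hr⟩ := hy
  by_cases hpq : p = q
  · subst hpq; simp [divisorTrans]
  by_cases hqr : q = r
  · subst hqr; simp [divisorTrans]
  have h1 := divisorEq_ne_zero hpq hp hq
  have h2 := divisorEq_ne_zero (Ne.symm hpq) hq hp
  by_cases hpr : p = r
  · subst hpr
    simp only [divisorTrans, hpq, hqr, if_true, if_false]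
    field_simp
  · simp only [divisorTrans, hpq, hqr, hpr, if_false]
    field_simp

/-- The line bundle `𝒪(D)` of a divisor `D`.  The local equations of `D` are the local expressions
of a meromorphic section with divisor `D`. -/
def divisorBundle [T2Space X] [IsManifold 𝓘(ℂ) ω X] (D : Function.locallyFinsupp X ℤ) :
    LineBundle X where
  ι := X
  core :=
    { baseSet := divisorNhd D
      isOpen_baseSet := fun p => (chartAt ℂ p).open_source.inter isOpen_interior
      indexAt := id
      mem_baseSet_at := mem_divisorNhd D
      coordChange := fun p q y => divisorTrans D p q y • ContinuousLinearMap.id ℂ ℂ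
      coordChange_self := fun p y _ v => by simp [divisorTrans]
      continuousOn_coordChange := fun p q =>
        (contMDiffOn_divisorTrans D p q).continuousOn.smul continuousOn_const
      coordChange_comp := fun p q r y hy v => by
        simp only [smul_apply, ContinuousLinearMap.id_apply, smul_eq_mul]
        rw [← divisorTrans_comp D p q r hy, mul_assoc] }
  holomorphic := ⟨fun p q => (contMDiffOn_divisorTrans D p q).smul contMDiffOn_const⟩

end Divisor

/-- `M` is the Wronskian line bundle `w(V)`: up to isomorphism, it is the line bundle of the divisor
`div(A)` of a generic meromorphic section `A` of `V`, computed in projectively flat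
trivialisations of `V`. -/
def HolBundle.IsWronskianLineBundle {X : Type u} [TopologicalSpace X] [ChartedSpace ℂ X]
    [T2Space X] [IsManifold 𝓘(ℂ) ω X] {n : ℕ} (V : HolBundle X (Fin n → ℂ))
    (M : LineBundle X) : Prop :=
  ∃ Z : HolBundle X (Fin n → ℂ), Z.HasPFTransitions ∧ Z.Iso V ∧
    ∃ A : Z.MeromorphicSection, A.IsGeneric ∧ M.Iso (divisorBundle A.wronskianDivisor)

end

/-! Differentiating `lam · (a ∘ phi)` repeatedly multiplies the Wronskian matrix of `a` by a lower
triangular matrix with diagonal entries `lam · phi' ^ j`, while a constant matrix `T` acts on the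
other side. Hence Wronskians pick up the factor `lam ^ n · phi' ^ (n(n-1)/2) · det T`
(`wronskian_mul_comp`, `wronskian_mulVec`). With `phi = id` this is `w(fA) = f ^ n w(A)`. For a
section in projectively flat frames it says that `w(A)` changes by the determinant of the frame
change and a power of the derivative of the coordinate change (`wronskianIn_change`), so its order
at a point is intrinsic.

For the comparison of line bundles, let `A` and `B` be generic sections of `Z` and `Y`, both with
projectively flat frames, and let `g` be an isomorphism from `Z ⊗ L` to `Y`; `g` need not be
projectively flat in any sense. In `det g · w(A) / w(B)` the coordinate derivatives cancel, as do
the determinants of the frame changes of `Z` and `Y`; only the `n`-th powers of the transition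
functions of `L` remain. Dividing `w(A)` and `w(B)` by local equations of their divisors leaves no
zeros or poles, which gives `𝒪(div A) ⊗ Lⁿ ≅ 𝒪(div B)` (`Iso.divisorBundle_tensor_pow`). Both
statements about `w(V ⊗ L)` are instances of this. -/

/-! ### Wronskians of rescaled, reparametrised and linearly transformed maps -/

section Wronskian

variable {n : ℕ} {phi lam : ℂ → ℂ} {w : ℂ}

/-- The coefficients are chosen before `a`, so one matrix serves all components of a vector-valued
map. The expansion holds near `w`, and `c l` vanishes identically for `l > j`, so that both survive
another differentiation. -/
lemma exists_iteratedDeriv_mul_comp_coeff (hphi : AnalyticAt ℂ phi w) (hlam : AnalyticAt ℂ lam w)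
    (j : ℕ) : ∃ c : ℕ → ℂ → ℂ, (∀ l, AnalyticAt ℂ (c l) w) ∧ (∀ l, j < l → c l = 0) ∧
      (c j = fun t => lam t * deriv phi t ^ j) ∧
      ∀ a : ℂ → ℂ, AnalyticAt ℂ a (phi w) →
        iteratedDeriv j (fun t => lam t * a (phi t)) =ᶠ[𝓝 w]
          fun t => ∑ l ∈ Finset.range (j + 1), c l t * iteratedDeriv l a (phi t) := by
  induction j with
  | zero =>
    refine ⟨fun l => if l = 0 then lam else 0, fun l => ?_, fun l hl => ?_, ?_, fun a _ => ?_⟩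
    · by_cases h : l = 0
      · simpa [h] using hlam
      · simpa [h] using! analyticAt_const
    · simp [hl.ne']
    · simp
    · simp
  | succ j ih =>
    obtain ⟨c, hc, hc0, hcj, hca⟩ := ih
    -- The product and chain rules give the recursion `c' l = (c l)' + c (l - 1) · phi'`; only the
    -- second term reaches the new diagonal.
    refine ⟨fun l t => deriv (c l) t + if l = 0 then 0 else c (l - 1) t * deriv phi t,
      fun l => ?_, fun l hl => ?_, ?_, fun a ha => ?_⟩
    · by_cases h : l = 0
      · simpa [h] using (hc 0).deriv
      · simp only [h, if_false]
        exact (hc l).deriv.add ((hc (l - 1)).mul hphi.deriv)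
    · funext t
      have h1 : l ≠ 0 := by lia
      simp [hc0 l (by lia), hc0 (l - 1) (by lia), h1]
    · funext t
      simp [hc0 (j + 1) (by lia), hcj, pow_succ, mul_assoc]
    · have hca' := (hca a ha).eventuallyEq_nhds
      have hphia : ∀ᶠ t in 𝓝 w, AnalyticAt ℂ a (phi t) :=
        hphi.continuousAt.eventually ha.eventually_analyticAt
      have hcan : ∀ᶠ t in 𝓝 w, ∀ l ∈ Finset.range (j + 1), AnalyticAt ℂ (c l) t :=
        (Filter.eventually_all_finset _).2 fun l _ => (hc l).eventually_analyticAt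
      filter_upwards [hca', hphia, hcan, hphi.eventually_analyticAt] with t ht hat hct hpt
      rw [iteratedDeriv_succ, ht.deriv_eq]
      have hd : ∀ l ∈ Finset.range (j + 1),
          HasDerivAt (fun s => c l s * iteratedDeriv l a (phi s))
            (deriv (c l) t * iteratedDeriv l a (phi t) +
              c l t * (iteratedDeriv (l + 1) a (phi t) * deriv phi t)) t := by
        intro l hl
        have h1 : HasDerivAt (iteratedDeriv l a) (iteratedDeriv (l + 1) a (phi t)) (phi t) := by
          rw [iteratedDeriv_succ]
          have := (hat.iterated_deriv l).differentiableAt.hasDerivAt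
          rwa [← iteratedDeriv_eq_iterate] at this
        exact (hct l hl).differentiableAt.hasDerivAt.mul
          (h1.comp t hpt.differentiableAt.hasDerivAt)
      rw [(HasDerivAt.fun_sum hd).deriv, Finset.sum_add_distrib]
      simp only [add_mul, Finset.sum_add_distrib]
      congr 1
      · rw [Finset.sum_range_succ _ (j + 1)]
        simp [hc0 (j + 1) (by lia)]
      · rw [Finset.sum_range_succ' _ (j + 1)]
        simp only [if_true, zero_mul, add_zero, Nat.add_sub_cancel, Nat.succ_ne_zero, if_false]
        exact Finset.sum_congr rfl fun l _ => by ring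

lemma wronskian_mul_comp {a : ℂ → Fin n → ℂ} (hphi : AnalyticAt ℂ phi w)
    (hlam : AnalyticAt ℂ lam w) (ha : AnalyticAt ℂ a (phi w)) :
    wronskian (fun t => lam t • a (phi t)) w
      = lam w ^ n * deriv phi w ^ (∑ j : Fin n, (j : ℕ)) * wronskian a (phi w) := by
  choose c hc hc0 hcj hca using exists_iteratedDeriv_mul_comp_coeff hphi hlam
  -- The row index is the order of differentiation, so the coefficient matrix acts from the left.
  have hM : (Matrix.of fun j k : Fin n =>
        iteratedDeriv (j : ℕ) (fun t => (lam t • a (phi t)) k) w)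
      = (Matrix.of fun j l : Fin n => c j l w) *
        (Matrix.of fun j k : Fin n => iteratedDeriv (j : ℕ) (fun t => a t k) (phi w)) := by
    ext j k
    have hak : AnalyticAt ℂ (fun t => a t k) (phi w) := analyticAt_pi_iff.1 ha k
    simp only [Matrix.of_apply, Matrix.mul_apply, Pi.smul_apply, smul_eq_mul]
    rw [(hca j _ hak).self_of_nhds,
      Fin.sum_univ_eq_sum_range fun l => c j l w * iteratedDeriv l (fun t => a t k) (phi w)]
    refine Finset.sum_subset (fun l hl => ?_) fun l _ hl => ?_
    · have := Finset.mem_range.1 hl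
      exact Finset.mem_range.2 (by lia)
    · rw [hc0 j l (by simpa using hl)]
      simp
  have hC : (Matrix.of fun j l : Fin n => c j l w).det
      = lam w ^ n * deriv phi w ^ (∑ j : Fin n, (j : ℕ)) := by
    rw [Matrix.det_of_isLowerTriangular]
    · simp [hcj, Finset.prod_mul_distrib, Finset.prod_pow_eq_pow_sum]
    · intro j l hjl
      have : j < l := by simpa using hjl
      simp [hc0 j l this]
  rw [wronskian, hM, Matrix.det_mul, hC, wronskian]

/-- Differentiation commutes with `T` because `T` is constant; this is where flatness up to scalars
enters. -/
lemma wronskian_mulVec {a : ℂ → Fin n → ℂ} (T : Matrix (Fin n) (Fin n) ℂ)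
    (ha : AnalyticAt ℂ a w) :
    wronskian (fun t => T.mulVec (a t)) w = T.det * wronskian a w := by
  have hM : (Matrix.of fun j k : Fin n => iteratedDeriv (j : ℕ) (fun t => T.mulVec (a t) k) w)
      = (Matrix.of fun j k : Fin n => iteratedDeriv (j : ℕ) (fun t => a t k) w) * T.transpose := by
    ext j k
    have hak (l : Fin n) : ContDiffAt ℂ (j : ℕ) (fun t => a t l) w :=
      (analyticAt_pi_iff.1 ha l).contDiffAt
    simp only [Matrix.of_apply, Matrix.mul_apply, Matrix.mulVec, dotProduct,
      Matrix.transpose_apply]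
    rw [iteratedDeriv_fun_sum fun l _ => contDiffAt_const.mul (hak l)]
    refine Finset.sum_congr rfl fun l _ => ?_
    rw [iteratedDeriv_const_mul (T k l) (hak l), mul_comm]
  rw [wronskian, hM, Matrix.det_mul, Matrix.det_transpose, mul_comm, wronskian]

lemma wronskian_congr {a b : ℂ → Fin n → ℂ} (h : a =ᶠ[𝓝 w] b) : wronskian a w = wronskian b w := by
  unfold wronskian
  congr 1
  ext j k
  exact Filter.EventuallyEq.iteratedDeriv_eq _ (h.mono fun t ht => congrFun ht k)

lemma meromorphicAt_pi_apply {a : ℂ → Fin n → ℂ} (ha : MeromorphicAt a w) (k : Fin n) :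
    MeromorphicAt (fun t => a t k) w := by
  obtain ⟨N, hN⟩ := ha
  exact ⟨N, by simpa using! analyticAt_pi_iff.1 hN k⟩

lemma MeromorphicAt.wronskian {a : ℂ → Fin n → ℂ} (ha : MeromorphicAt a w) :
    MeromorphicAt (wronskian a) w := by
  have : _root_.wronskian a = fun t => ∑ σ : Equiv.Perm (Fin n), ((Equiv.Perm.sign σ : ℤ) : ℂ) *
      ∏ k, iteratedDeriv ((σ k : Fin n) : ℕ) (fun t => a t k) t := by
    funext t
    simp [_root_.wronskian, Matrix.det_apply']
  rw [this]
  refine MeromorphicAt.fun_sum fun σ _ => (MeromorphicAt.const _ _).mul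
    (MeromorphicAt.fun_prod fun k _ => ?_)
  rw [iteratedDeriv_eq_iterate]
  exact (meromorphicAt_pi_apply ha k).iterated_deriv

end Wronskian

/-! ### Isomorphisms of holomorphic bundles -/

namespace HolBundle

variable {X : Type u} [TopologicalSpace X] [ChartedSpace ℂ X]
  {F : Type*} [NormedAddCommGroup F] [NormedSpace ℂ F] {U V W : HolBundle X F}

lemma isUnit_smul_of_ne_zero {c : ℂ} (hc : c ≠ 0) {f : F →L[ℂ] F} (hf : IsUnit f) :
    IsUnit (c • f) := by
  rw [Algebra.smul_def]
  exact ((IsUnit.mk0 c hc).map (algebraMap ℂ (F →L[ℂ] F))).mul hf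

lemma isUnit_coordChange (V : HolBundle X F) {i j : V.ι} {x : X}
    (hx : x ∈ V.core.baseSet i ∩ V.core.baseSet j) : IsUnit (V.core.coordChange i j x) := by
  refine ⟨⟨V.core.coordChange i j x, V.core.coordChange j i x, ?_, ?_⟩, rfl⟩ <;> ext v
  · simp [V.core.coordChange_comp j i j x ⟨⟨hx.2, hx.1⟩, hx.2⟩,
      V.core.coordChange_self j x hx.2]
  · simp [V.core.coordChange_comp i j i x ⟨hx, hx.1⟩, V.core.coordChange_self i x hx.1]

lemma trans_ne_zero (L : LineBundle X) {k l : L.ι} {x : X}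
    (hx : x ∈ L.core.baseSet k ∩ L.core.baseSet l) : L.trans k l x ≠ 0 := by
  intro h
  have := L.trans_comp k l k ⟨hx, hx.1⟩
  rw [h, mul_zero, L.trans_self k hx.1] at this
  exact zero_ne_one this

lemma coordChange_apply (L : LineBundle X) (k l : L.ι) (x : X) (v : ℂ) :
    L.core.coordChange k l x v = L.trans k l x * v := by
  rw [trans, ← smul_eq_mul, ← mul_one v, ← smul_eq_mul v, map_smul, smul_eq_mul, smul_eq_mul,
    smul_eq_mul, mul_one, mul_comm]

lemma Iso.refl (V : HolBundle X F) : V.Iso V := by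
  refine ⟨V.core.coordChange, V.holomorphic.contMDiffOn_coordChange,
    fun i k x hx => V.isUnit_coordChange hx, fun i j k l x hx v => ?_⟩
  rw [V.core.coordChange_comp i k l x ⟨⟨hx.1.1, hx.2.1⟩, hx.2.2⟩,
    V.core.coordChange_comp i j l x ⟨hx.1, hx.2.2⟩]

/-- The composite passes through the frame `indexAt x` of `V`, which may jump with `x`. By `key` it
does not depend on that frame, so near each point a fixed one can be used to check holomorphy. -/
lemma Iso.trans (h₁ : U.Iso V) (h₂ : V.Iso W) : U.Iso W := by
  obtain ⟨g, hg, hgu, hgc⟩ := h₁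
  obtain ⟨h, hh, hhu, hhc⟩ := h₂
  have key : ∀ i j j' l x, x ∈ U.core.baseSet i → x ∈ V.core.baseSet j → x ∈ V.core.baseSet j' →
      x ∈ W.core.baseSet l → h j l x * g i j x = h j' l x * g i j' x := by
    intro i j j' l x hi hj hj' hl
    ext v
    have e₁ := hgc i i j j' x ⟨⟨hi, hi⟩, hj, hj'⟩ v
    have e₂ := hhc j j' l l x ⟨⟨hj, hj'⟩, hl, hl⟩ (g i j x v)
    rw [U.core.coordChange_self i x hi] at e₁
    rw [W.core.coordChange_self l x hl, e₁] at e₂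
    exact e₂
  refine ⟨fun i l x => h (V.core.indexAt x) l x * g i (V.core.indexAt x) x,
    fun i l x hx => ?_, fun i l x hx => ?_, fun i j k l x hx v => ?_⟩
  · set m := V.core.indexAt x
    have hm : x ∈ V.core.baseSet m := V.core.mem_baseSet_at x
    have hsm : ContMDiffWithinAt 𝓘(ℂ) 𝓘(ℂ, F →L[ℂ] F) ω (fun y => h m l y * g i m y)
        (U.core.baseSet i ∩ W.core.baseSet l) x := by
      have h1 := (hh m l).contMDiffAt
        (((V.core.isOpen_baseSet m).inter (W.core.isOpen_baseSet l)).mem_nhds ⟨hm, hx.2⟩)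
      have h2 := (hg i m).contMDiffAt
        (((U.core.isOpen_baseSet i).inter (V.core.isOpen_baseSet m)).mem_nhds ⟨hx.1, hm⟩)
      exact (h1.clm_comp h2).contMDiffWithinAt
    refine hsm.congr_of_eventuallyEq ?_ rfl
    filter_upwards [self_mem_nhdsWithin,
      mem_nhdsWithin_of_mem_nhds ((V.core.isOpen_baseSet m).mem_nhds hm)] with y hy hym
    exact key i _ _ l y hy.1 (V.core.mem_baseSet_at y) hym hy.2
  · exact (hhu _ _ x ⟨V.core.mem_baseSet_at x, hx.2⟩).mul
      (hgu _ _ x ⟨hx.1, V.core.mem_baseSet_at x⟩)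
  · have hm := V.core.mem_baseSet_at x
    have e₁ := hgc i j _ _ x ⟨hx.1, hm, hm⟩ v
    have e₂ := hhc _ _ k l x ⟨⟨hm, hm⟩, hx.2⟩ (g i (V.core.indexAt x) x v)
    rw [V.core.coordChange_self _ x hm] at e₁ e₂
    exact e₂.trans (congrArg _ e₁)

lemma Iso.symm [CompleteSpace F] (h : V.Iso W) : W.Iso V := by
  obtain ⟨g, hg, hgu, hgc⟩ := h
  have inv_left : ∀ i k x, x ∈ V.core.baseSet i ∩ W.core.baseSet k → ∀ v,
      Ring.inverse (g i k x) (g i k x v) = v := fun i k x hx v => by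
    rw [← mul_apply_eq_comp, Ring.inverse_mul_cancel _ (hgu i k x hx),
      one_apply_eq_self]
  have inv_right : ∀ i k x, x ∈ V.core.baseSet i ∩ W.core.baseSet k → ∀ v,
      g i k x (Ring.inverse (g i k x) v) = v := fun i k x hx v => by
    rw [← mul_apply_eq_comp, Ring.mul_inverse_cancel _ (hgu i k x hx),
      one_apply_eq_self]
  refine ⟨fun k i x => Ring.inverse (g i k x), fun k i x hx => ?_, fun k i x hx => ?_,
    fun k l i j x hx v => ?_⟩
  · obtain ⟨u, hu⟩ := hgu i k x hx.symm
    -- Inversion is analytic at units of the Banach algebra `F →L[ℂ] F`; hence completeness of `F`.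
    have h1 := contDiffAt_ringInverse ℂ (n := ω) u
    rw [hu] at h1
    exact (h1.comp_contMDiffWithinAt ((hg i k) x hx.symm)).mono fun y hy => hy.symm
  · exact (hgu i k x hx.symm).ringInverse
  · have e := hgc i j k l x ⟨hx.2, hx.1⟩ (Ring.inverse (g i k x) v)
    rw [inv_right i k x ⟨hx.2.1, hx.1.1⟩] at e
    rw [e, inv_left j l x ⟨hx.2.2, hx.1.2⟩]

lemma Iso.tensor (h : V.Iso W) (L : LineBundle X) : (V.tensor L).Iso (W.tensor L) := by
  obtain ⟨g, hg, hgu, hgc⟩ := h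
  refine ⟨fun p q x => L.trans p.2 q.2 x • g p.1 q.1 x, fun p q => ?_, fun p q x hx => ?_,
    fun p p' q q' x hx v => ?_⟩
  · exact ((L.contMDiffOn_trans p.2 q.2).mono fun _ hx => ⟨hx.1.2, hx.2.2⟩).smul
      ((hg p.1 q.1).mono fun _ hx => ⟨hx.1.1, hx.2.1⟩)
  · exact isUnit_smul_of_ne_zero (L.trans_ne_zero ⟨hx.1.2, hx.2.2⟩) (hgu p.1 q.1 x ⟨hx.1.1, hx.2.1⟩)
  · have e := hgc p.1 p'.1 q.1 q'.1 x ⟨⟨hx.1.1.1, hx.1.2.1⟩, hx.2.1.1, hx.2.2.1⟩ v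
    have t₁ := L.trans_comp p.2 q.2 q'.2 ⟨⟨hx.1.1.2, hx.2.1.2⟩, hx.2.2.2⟩
    have t₂ := L.trans_comp p.2 p'.2 q'.2 ⟨⟨hx.1.1.2, hx.1.2.2⟩, hx.2.2.2⟩
    simp only [HolBundle.tensor, smul_apply, map_smul, smul_smul, e]
    rw [mul_comm (L.trans p.2 q.2 x), t₁, mul_comm (L.trans p.2 p'.2 x), t₂]

lemma HasPFTransitions.tensor {n : ℕ} {Z : HolBundle X (Fin n → ℂ)} (hZ : Z.HasPFTransitions)
    (L : LineBundle X) : (Z.tensor L).HasPFTransitions := by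
  intro p q
  obtain ⟨lam, T, hlam, h⟩ := hZ p.1 q.1
  refine ⟨fun x => L.trans p.2 q.2 x * lam x, T, ?_, fun x hx => ⟨?_, fun v => ?_⟩⟩
  · exact ((L.contMDiffOn_trans p.2 q.2).mono fun _ hx => ⟨hx.1.2, hx.2.2⟩).mul
      (hlam.mono fun _ hx => ⟨hx.1.1, hx.2.1⟩)
  · exact mul_ne_zero (L.trans_ne_zero ⟨hx.1.2, hx.2.2⟩) (h x ⟨hx.1.1, hx.2.1⟩).1
  · simp only [HolBundle.tensor, smul_apply, (h x ⟨hx.1.1, hx.2.1⟩).2 v, smul_smul]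

lemma IsProjectivelyFlat.tensor {n : ℕ} {V : HolBundle X (Fin n → ℂ)} (hV : V.IsProjectivelyFlat)
    (L : LineBundle X) : (V.tensor L).IsProjectivelyFlat := by
  obtain ⟨Z, hZ, h⟩ := hV
  exact ⟨Z.tensor L, hZ.tensor L, h.tensor L⟩

end HolBundle

/-! ### Punctured neighbourhoods and charts -/

section Charts

lemma eventually_nhds_eventually_nhdsNE {Y : Type*} [TopologicalSpace Y] [T1Space Y] {x : Y}
    {p : Y → Prop} (h : ∀ᶠ y in 𝓝[≠] x, p y) : ∀ᶠ y in 𝓝 x, ∀ᶠ z in 𝓝[≠] y, p z := by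
  rw [← nhdsNE_sup_pure, eventually_sup]
  exact ⟨(eventually_nhdsNE_eventually_nhds_iff.2 h).mono fun y hy =>
    hy.filter_mono nhdsWithin_le_nhds, h⟩

lemma OpenPartialHomeomorph.tendsto_nhdsNE {Y Y' : Type*} [TopologicalSpace Y]
    [TopologicalSpace Y'] (e : OpenPartialHomeomorph Y Y') {x : Y} (hx : x ∈ e.source) :
    Tendsto e (𝓝[≠] x) (𝓝[≠] (e x)) := by
  refine tendsto_nhdsWithin_iff.2 ⟨(e.continuousAt hx).tendsto.mono_left nhdsWithin_le_nhds, ?_⟩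
  filter_upwards [self_mem_nhdsWithin, mem_nhdsWithin_of_mem_nhds (e.open_source.mem_nhds hx)]
    with y hy hys h
  exact hy (e.injOn hys hx h)

lemma OpenPartialHomeomorph.tendsto_symm_nhdsNE {Y Y' : Type*} [TopologicalSpace Y]
    [TopologicalSpace Y'] (e : OpenPartialHomeomorph Y Y') {x : Y} (hx : x ∈ e.source) :
    Tendsto e.symm (𝓝[≠] (e x)) (𝓝[≠] x) := by
  simpa [e.left_inv hx] using e.symm.tendsto_nhdsNE (e.map_source hx)

variable {X : Type u} [TopologicalSpace X] [ChartedSpace ℂ X]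

lemma nhdsNE_neBot_of_chartedSpace (x : X) : (𝓝[≠] x).NeBot :=
  ((chartAt ℂ x).tendsto_symm_nhdsNE (mem_chart_source ℂ x)).neBot

variable {E : Type*} [NormedAddCommGroup E] [NormedSpace ℂ E]

/-- Holomorphy in terms of a coordinate. -/
lemma contMDiffAt_iff_analyticAt_comp_symm [CompleteSpace E] {f : X → E} {x : X}
    {e : OpenPartialHomeomorph X ℂ} (he : e ∈ IsManifold.maximalAtlas 𝓘(ℂ) ω X)
    (hx : x ∈ e.source) :
    ContMDiffAt 𝓘(ℂ) 𝓘(ℂ, E) ω f x ↔ AnalyticAt ℂ (f ∘ e.symm) (e x) := by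
  have key : AnalyticAt ℂ (f ∘ e.symm) (e x) ↔
      ContMDiffAt 𝓘(ℂ) 𝓘(ℂ, E) ω (f ∘ e.symm) (e x) := by
    rw [contMDiffAt_iff_contDiffAt]
    exact ⟨fun h => h.contDiffAt, fun h => h.analyticAt⟩
  rw [key]
  constructor
  · intro h
    have h1 := contMDiffAt_symm_of_mem_maximalAtlas he (e.map_source hx)
    refine ContMDiffAt.comp (e x) ?_ h1
    rwa [e.left_inv hx]
  · intro h
    have h1 := h.comp x (contMDiffAt_of_mem_maximalAtlas he hx)
    refine h1.congr_of_eventuallyEq ?_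
    filter_upwards [e.open_source.mem_nhds hx] with y hy
    simp [e.left_inv hy]

lemma MeromorphicAt.eventually_contMDiffAt [CompleteSpace E] {f : X → E} {x : X}
    {e : OpenPartialHomeomorph X ℂ} (he : e ∈ IsManifold.maximalAtlas 𝓘(ℂ) ω X)
    (hx : x ∈ e.source) (h : MeromorphicAt (f ∘ e.symm) (e x)) :
    ∀ᶠ y in 𝓝[≠] x, ContMDiffAt 𝓘(ℂ) 𝓘(ℂ, E) ω f y := by
  filter_upwards [(e.tendsto_nhdsNE hx).eventually h.eventually_analyticAt,
    mem_nhdsWithin_of_mem_nhds (e.open_source.mem_nhds hx)] with y hy hys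
  exact (contMDiffAt_iff_analyticAt_comp_symm he hys).2 hy

/-- A meromorphic function of order zero is holomorphic and nonvanishing after removal of the
singularity. -/
lemma exists_contMDiffAt_of_meromorphicOrderAt_eq_zero [IsManifold 𝓘(ℂ) ω X] {f : X → ℂ} {x : X}
    (h : MeromorphicAt (f ∘ (chartAt ℂ x).symm) (chartAt ℂ x x))
    (h0 : meromorphicOrderAt (f ∘ (chartAt ℂ x).symm) (chartAt ℂ x x) = 0) :
    ∃ H : X → ℂ, ContMDiffAt 𝓘(ℂ) 𝓘(ℂ) ω H x ∧ H x ≠ 0 ∧ f =ᶠ[𝓝[≠] x] H := by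
  obtain ⟨g, hg, hg0, hgf⟩ := (meromorphicOrderAt_eq_int_iff (n := 0) h).1 h0
  refine ⟨g ∘ chartAt ℂ x, hg.contDiffAt.contMDiffAt.comp x (contMDiffAt_of_mem_maximalAtlas
    (IsManifold.chart_mem_maximalAtlas x) (mem_chart_source ℂ x)), hg0, ?_⟩
  filter_upwards [((chartAt ℂ x).tendsto_nhdsNE (mem_chart_source ℂ x)).eventually hgf,
    mem_nhdsWithin_of_mem_nhds ((chartAt ℂ x).open_source.mem_nhds (mem_chart_source ℂ x))]
    with y hy hys
  simpa [(chartAt ℂ x).left_inv hys] using hy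

end Charts

/-! ### Isomorphisms of line bundles given up to isolated points -/

namespace HolBundle

variable {X : Type u} [TopologicalSpace X] [ChartedSpace ℂ X]

/-- An isomorphism of line bundles may be given by scalar functions which are specified only up to
isolated points, provided that the singularities are removable. -/
lemma Iso.of_eventually [T2Space X] [IsManifold 𝓘(ℂ) ω X] {P Q : LineBundle X}
    (G : P.ι → Q.ι → X → ℂ)
    (hG : ∀ p q, ∀ x ∈ P.core.baseSet p ∩ Q.core.baseSet q, ∃ H : X → ℂ,
      ContMDiffAt 𝓘(ℂ) 𝓘(ℂ) ω H x ∧ H x ≠ 0 ∧ G p q =ᶠ[𝓝[≠] x] H)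
    (hc : ∀ p p' q q', ∀ x ∈ (P.core.baseSet p ∩ P.core.baseSet p') ∩
        (Q.core.baseSet q ∩ Q.core.baseSet q'),
      ∀ᶠ y in 𝓝[≠] x, Q.trans q q' y * G p q y = G p' q' y * P.trans p p' y) : P.Iso Q := by
  have hne : ∀ x : X, (𝓝[≠] x).NeBot := nhdsNE_neBot_of_chartedSpace
  -- The punctured limit removes the singularities without choices, so it agrees with every local
  -- extension `H` on a full neighbourhood.
  have hlim : ∀ p q, ∀ x ∈ P.core.baseSet p ∩ Q.core.baseSet q, ∃ H : X → ℂ,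
      ContMDiffAt 𝓘(ℂ) 𝓘(ℂ) ω H x ∧ H x ≠ 0 ∧ G p q =ᶠ[𝓝[≠] x] H ∧
        (fun y => limUnder (𝓝[≠] y) (G p q)) =ᶠ[𝓝 x] H := by
    intro p q x hx
    obtain ⟨H, hH, hH0, hGH⟩ := hG p q x hx
    refine ⟨H, hH, hH0, hGH, ?_⟩
    have h2 : ∀ᶠ y in 𝓝 x, ContMDiffAt 𝓘(ℂ) 𝓘(ℂ) ω H y :=
      (contMDiffAt_iff_contMDiffAt_nhds (by simp)).1 hH
    filter_upwards [eventually_nhds_eventually_nhdsNE hGH, h2] with y hy hcy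
    have := hne y
    exact ((hcy.continuousAt.tendsto.mono_left nhdsWithin_le_nhds).congr'
      (EventuallyEq.symm hy)).limUnder_eq
  refine ⟨fun p q x => limUnder (𝓝[≠] x) (G p q) • ContinuousLinearMap.id ℂ ℂ,
    fun p q x hx => ?_, fun p q x hx => ?_, fun p p' q q' x hx v => ?_⟩
  · obtain ⟨H, hH, -, -, hl⟩ := hlim p q x hx
    exact ((hH.congr_of_eventuallyEq hl).smul contMDiffAt_const).contMDiffWithinAt
  · obtain ⟨H, hH, hH0, -, hl⟩ := hlim p q x hx
    refine isUnit_smul_of_ne_zero ?_ isUnit_one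
    have e : limUnder (𝓝[≠] x) (G p q) = H x := hl.self_of_nhds
    rwa [e]
  · obtain ⟨H, hH, -, hGH, hl⟩ := hlim p q x ⟨hx.1.1, hx.2.1⟩
    obtain ⟨H', hH', -, hGH', hl'⟩ := hlim p' q' x ⟨hx.1.2, hx.2.2⟩
    have := hne x
    have hQ := ((Q.contMDiffOn_trans q q').contMDiffAt
      (((Q.core.isOpen_baseSet q).inter (Q.core.isOpen_baseSet q')).mem_nhds hx.2)).continuousAt
    have hP := ((P.contMDiffOn_trans p p').contMDiffAt
      (((P.core.isOpen_baseSet p).inter (P.core.isOpen_baseSet p')).mem_nhds hx.1)).continuousAt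
    -- Compatibility is known only off `x`; both sides are continuous, so it extends to `x`.
    have e : Q.trans q q' x * H x = H' x * P.trans p p' x := by
      refine tendsto_nhds_unique
        ((hQ.mul hH.continuousAt).tendsto.mono_left (nhdsWithin_le_nhds (s := {x}ᶜ)))
        (((hH'.continuousAt.mul hP).tendsto.mono_left nhdsWithin_le_nhds).congr' ?_)
      filter_upwards [hGH, hGH', hc p p' q q' x hx] with y h1 h2 h3
      simp only [Pi.mul_apply]
      rw [← h1, ← h2, h3]
    simp only [smul_apply, ContinuousLinearMap.id_apply, smul_eq_mul, coordChange_apply]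
    have e₁ : limUnder (𝓝[≠] x) (G p q) = H x := hl.self_of_nhds
    have e₂ : limUnder (𝓝[≠] x) (G p' q') = H' x := hl'.self_of_nhds
    rw [e₁, e₂, ← mul_assoc, e, mul_assoc]

end HolBundle

/-! ### Change of coordinate and of frame for Wronskians of sections -/

lemma AnalyticAt.wronskian {n : ℕ} {a : ℂ → Fin n → ℂ} {w : ℂ} (ha : AnalyticAt ℂ a w) :
    AnalyticAt ℂ (wronskian a) w := by
  have : _root_.wronskian a = fun t => ∑ σ : Equiv.Perm (Fin n), ((Equiv.Perm.sign σ : ℤ) : ℂ) *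
      ∏ k, iteratedDeriv ((σ k : Fin n) : ℕ) (fun t => a t k) t := by
    funext t
    simp [_root_.wronskian, Matrix.det_apply']
  rw [this]
  refine Finset.analyticAt_fun_sum _ fun σ _ => analyticAt_const.mul
    (Finset.analyticAt_fun_prod _ fun k _ => ?_)
  rw [iteratedDeriv_eq_iterate]
  exact (analyticAt_pi_iff.1 ha k).iterated_deriv _

section ChartChange

variable {X : Type u} [TopologicalSpace X] [ChartedSpace ℂ X]
  {e e' : OpenPartialHomeomorph X ℂ} {y : X}

lemma analyticAt_chartChange (he : e ∈ IsManifold.maximalAtlas 𝓘(ℂ) ω X)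
    (he' : e' ∈ IsManifold.maximalAtlas 𝓘(ℂ) ω X) (hy : y ∈ e.source) (hy' : y ∈ e'.source) :
    AnalyticAt ℂ (e ∘ e'.symm) (e' y) :=
  (contMDiffAt_iff_analyticAt_comp_symm he' hy').1 (contMDiffAt_of_mem_maximalAtlas he hy)

lemma deriv_chartChange_ne_zero (he : e ∈ IsManifold.maximalAtlas 𝓘(ℂ) ω X)
    (he' : e' ∈ IsManifold.maximalAtlas 𝓘(ℂ) ω X) (hy : y ∈ e.source) (hy' : y ∈ e'.source) :
    deriv (e ∘ e'.symm) (e' y) ≠ 0 := by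
  have h₁ := (analyticAt_chartChange he he' hy hy').differentiableAt.hasDerivAt
  have h₂ := (analyticAt_chartChange he' he hy' hy).differentiableAt.hasDerivAt
  have hs : e y = (e ∘ e'.symm) (e' y) := by simp [e'.left_inv hy']
  rw [hs] at h₂
  have h₃ := h₂.comp (e' y) h₁
  have hid : ((e' ∘ e.symm) ∘ (e ∘ e'.symm)) =ᶠ[𝓝 (e' y)] id := by
    have hc : ContinuousAt e'.symm (e' y) := e'.continuousAt_symm (e'.map_source hy')
    filter_upwards [e'.open_target.mem_nhds (e'.map_source hy'),
      hc.eventually (e.open_source.mem_nhds (by rwa [e'.left_inv hy']))] with t ht hts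
    simp only [Function.comp_apply, id]
    rw [e.left_inv hts, e'.right_inv ht]
  have h₄ := (h₃.congr_of_eventuallyEq hid.symm).unique (hasDerivAt_id (e' y))
  intro h
  rw [h, mul_zero] at h₄
  exact zero_ne_one h₄

end ChartChange

namespace HolBundle

variable {X : Type u} [TopologicalSpace X] [ChartedSpace ℂ X] {n : ℕ}

lemma isUnit_det {f : (Fin n → ℂ) →L[ℂ] (Fin n → ℂ)} (hf : IsUnit f) : f.det ≠ 0 := by
  have h := hf.map (ContinuousLinearMap.toLinearMapRingHom (R₁ := ℂ) (M₁ := Fin n → ℂ))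
  exact (h.map LinearMap.det).ne_zero

/-- The factor `c ^ n · det T` produced by the Wronskian is thus the determinant of the frame
change, and the non-unique splitting into scalar and constant matrix disappears. -/
lemma det_eq_of_forall_apply {f : (Fin n → ℂ) →L[ℂ] (Fin n → ℂ)} {c : ℂ}
    {T : Matrix (Fin n) (Fin n) ℂ} (h : ∀ v, f v = c • T.mulVec v) : f.det = c ^ n * T.det := by
  have : (f : (Fin n → ℂ) →ₗ[ℂ] (Fin n → ℂ)) = c • Matrix.toLin' T := by
    ext1 v
    ext1
    simp [h]
  rw [ContinuousLinearMap.det, this, LinearMap.det_smul, LinearMap.det_toLin']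
  simp

namespace MeromorphicSection

variable {Z : HolBundle X (Fin n → ℂ)}

/-- The Wronskian of `A` at `y`, in the preferred coordinate and frame at `y`. -/
noncomputable def wronskianAt (A : Z.MeromorphicSection) (y : X) : ℂ :=
  A.wronskianIn (chartAt ℂ y) (Z.core.indexAt y) (chartAt ℂ y y)

/-- The Wronskian of `A` near `x`, in the preferred coordinate and frame at `x`. -/
noncomputable def wronskianNear (A : Z.MeromorphicSection) (x y : X) : ℂ :=
  A.wronskianIn (chartAt ℂ x) (Z.core.indexAt x) (chartAt ℂ x y)

lemma meromorphicAt_wronskianIn (A : Z.MeromorphicSection) (x : X) :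
    MeromorphicAt (A.wronskianIn (chartAt ℂ x) (Z.core.indexAt x)) (chartAt ℂ x x) :=
  (A.meromorphic _ x (Z.core.mem_baseSet_at x)).wronskian

lemma wronskianNear_comp_symm (A : Z.MeromorphicSection) (x : X) :
    A.wronskianNear x ∘ (chartAt ℂ x).symm =ᶠ[𝓝[≠] (chartAt ℂ x x)]
      A.wronskianIn (chartAt ℂ x) (Z.core.indexAt x) := by
  filter_upwards [mem_nhdsWithin_of_mem_nhds
    ((chartAt ℂ x).open_target.mem_nhds (mem_chart_target ℂ x))] with t ht
  simp [wronskianNear, (chartAt ℂ x).right_inv ht]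

lemma eventually_wronskianNear_ne_zero (A : Z.MeromorphicSection) {x : X}
    (hx : A.wronskianOrder x ≠ ⊤) : ∀ᶠ y in 𝓝[≠] x, A.wronskianNear x y ≠ 0 :=
  ((chartAt ℂ x).tendsto_nhdsNE (mem_chart_source ℂ x)).eventually
    ((meromorphicOrderAt_ne_top_iff_eventually_ne_zero (A.meromorphicAt_wronskianIn x)).1 hx)

/-- In the coordinate `e'` the new local expression is `lam · T (a ∘ phi)`, with `phi` the
coordinate change and `a` the old expression. -/
lemma wronskianIn_change (hZ : Z.HasPFTransitions) (A : Z.MeromorphicSection) {y : X} {i j : Z.ι}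
    (hij : y ∈ Z.core.baseSet i ∩ Z.core.baseSet j) {e e' : OpenPartialHomeomorph X ℂ}
    (he : e ∈ IsManifold.maximalAtlas 𝓘(ℂ) ω X) (he' : e' ∈ IsManifold.maximalAtlas 𝓘(ℂ) ω X)
    (hy : y ∈ e.source) (hy' : y ∈ e'.source)
    (hA : ContMDiffAt 𝓘(ℂ) 𝓘(ℂ, Fin n → ℂ) ω (A.loc i) y) :
    A.wronskianIn e' j (e' y) = (Z.core.coordChange i j y).det *
      deriv (e ∘ e'.symm) (e' y) ^ (∑ k : Fin n, (k : ℕ)) * A.wronskianIn e i (e y) := by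
  obtain ⟨lam, T, hlam, h⟩ := hZ i j
  have hopen := (Z.core.isOpen_baseSet i).inter (Z.core.isOpen_baseSet j)
  have hs : (e ∘ e'.symm) (e' y) = e y := by simp [e'.left_inv hy']
  have ha : AnalyticAt ℂ (A.loc i ∘ e.symm) (e y) :=
    (contMDiffAt_iff_analyticAt_comp_symm he hy).1 hA
  have hTa : AnalyticAt ℂ (fun t => (T : Matrix (Fin n) (Fin n) ℂ).mulVec ((A.loc i ∘ e.symm) t))
      ((e ∘ e'.symm) (e' y)) := by
    rw [hs]
    exact ((Matrix.mulVecLin (T : Matrix (Fin n) (Fin n) ℂ)).toContinuousLinearMap.analyticAt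
      _).comp ha
  have hl : AnalyticAt ℂ (lam ∘ e'.symm) (e' y) :=
    (contMDiffAt_iff_analyticAt_comp_symm he' hy').1 (hlam.contMDiffAt (hopen.mem_nhds hij))
  have hc : ContinuousAt e'.symm (e' y) := e'.continuousAt_symm (e'.map_source hy')
  have hE : A.loc j ∘ e'.symm =ᶠ[𝓝 (e' y)] fun t => (lam ∘ e'.symm) t •
      (T : Matrix (Fin n) (Fin n) ℂ).mulVec ((A.loc i ∘ e.symm) ((e ∘ e'.symm) t)) := by
    filter_upwards [hc.eventually (e.open_source.mem_nhds (by rwa [e'.left_inv hy'])),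
      hc.eventually (hopen.mem_nhds (by rwa [e'.left_inv hy']))] with t ht htu
    simp only [Function.comp_apply]
    rw [e.left_inv ht, A.compat i j _ htu, (h _ htu).2]
  rw [wronskianIn, wronskian_congr hE, wronskian_mul_comp
      (a := fun t => (T : Matrix (Fin n) (Fin n) ℂ).mulVec ((A.loc i ∘ e.symm) t))
      (analyticAt_chartChange he he' hy hy') hl hTa, hs, wronskian_mulVec _ ha,
    det_eq_of_forall_apply (h y hij).2, wronskianIn, Function.comp_apply, e'.left_inv hy']
  ring

variable [IsManifold 𝓘(ℂ) ω X]

lemma eventually_contMDiffAt (A : Z.MeromorphicSection) {x : X} {i : Z.ι}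
    (hx : x ∈ Z.core.baseSet i) :
    ∀ᶠ y in 𝓝[≠] x, ContMDiffAt 𝓘(ℂ) 𝓘(ℂ, Fin n → ℂ) ω (A.loc i) y :=
  (A.meromorphic i x hx).eventually_contMDiffAt (IsManifold.chart_mem_maximalAtlas x)
    (mem_chart_source ℂ x)

/-- One punctured neighbourhood works for all frames `j` and charts `z`; hence `j` and `z` may later
depend on `y`. -/
lemma eventually_wronskianIn_eq (hZ : Z.HasPFTransitions) (A : Z.MeromorphicSection) (x : X) :
    ∀ᶠ y in 𝓝[≠] x, y ∈ Z.core.baseSet (Z.core.indexAt x) ∧ y ∈ (chartAt ℂ x).source ∧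
      ContMDiffAt 𝓘(ℂ) 𝓘(ℂ, Fin n → ℂ) ω (A.loc (Z.core.indexAt x)) y ∧
      ∀ j, y ∈ Z.core.baseSet j → ∀ z, y ∈ (chartAt ℂ z).source →
        A.wronskianIn (chartAt ℂ z) j (chartAt ℂ z y) =
          (Z.core.coordChange (Z.core.indexAt x) j y).det *
          deriv (chartAt ℂ x ∘ (chartAt ℂ z).symm) (chartAt ℂ z y) ^ (∑ k : Fin n, (k : ℕ)) *
          A.wronskianNear x y := by
  have hx := Z.core.mem_baseSet_at x
  filter_upwards [A.eventually_contMDiffAt hx,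
    mem_nhdsWithin_of_mem_nhds ((Z.core.isOpen_baseSet _).mem_nhds hx),
    mem_nhdsWithin_of_mem_nhds ((chartAt ℂ x).open_source.mem_nhds (mem_chart_source ℂ x))]
    with y hy hyi hyc
  exact ⟨hyi, hyc, hy, fun j hj z hz => A.wronskianIn_change hZ ⟨hyi, hj⟩
    (IsManifold.chart_mem_maximalAtlas x) (IsManifold.chart_mem_maximalAtlas z) hyc hz hy⟩

/-- Near `x`, but off it, the Wronskian is holomorphic and nonzero in the coordinate at `x`, and
passing to the coordinate and frame at `y` multiplies it by nonzero factors. -/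
lemma eventually_wronskianOrder_eq_zero (hZ : Z.HasPFTransitions) (A : Z.MeromorphicSection)
    {x : X} (hx : A.wronskianOrder x ≠ ⊤) : ∀ᶠ y in 𝓝[≠] x, A.wronskianOrder y = 0 := by
  filter_upwards [A.eventually_wronskianNear_ne_zero hx, A.eventually_wronskianIn_eq hZ x]
    with y hy ⟨hyi, hyc, hyA, h⟩
  have hyj := Z.core.mem_baseSet_at y
  have hyA' : ContMDiffAt 𝓘(ℂ) 𝓘(ℂ, Fin n → ℂ) ω (A.loc (Z.core.indexAt y)) y := by
    have hopen := (Z.core.isOpen_baseSet (Z.core.indexAt x)).inter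
      (Z.core.isOpen_baseSet (Z.core.indexAt y))
    have h1 := (Z.holomorphic.contMDiffOn_coordChange (Z.core.indexAt x)
      (Z.core.indexAt y)).contMDiffAt (hopen.mem_nhds ⟨hyi, hyj⟩)
    refine (h1.clm_apply hyA).congr_of_eventuallyEq ?_
    filter_upwards [hopen.mem_nhds ⟨hyi, hyj⟩] with z hz
    exact A.compat _ _ z hz
  have han : AnalyticAt ℂ (A.wronskianIn (chartAt ℂ y) (Z.core.indexAt y)) (chartAt ℂ y y) :=
    ((contMDiffAt_iff_analyticAt_comp_symm (IsManifold.chart_mem_maximalAtlas y)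
      (mem_chart_source ℂ y)).1 hyA').wronskian
  have hne : A.wronskianIn (chartAt ℂ y) (Z.core.indexAt y) (chartAt ℂ y y) ≠ 0 := by
    rw [h _ hyj y (mem_chart_source ℂ y)]
    exact mul_ne_zero (mul_ne_zero (isUnit_det (Z.isUnit_coordChange ⟨hyi, hyj⟩))
      (pow_ne_zero _ (deriv_chartChange_ne_zero (IsManifold.chart_mem_maximalAtlas x)
        (IsManifold.chart_mem_maximalAtlas y) hyc (mem_chart_source ℂ y)))) hy
  rw [wronskianOrder, han.meromorphicOrderAt_eq, han.analyticOrderAt_eq_zero.2 hne]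
  rfl

variable [T2Space X]

lemma eventually_wronskianOrder_eq_top (hZ : Z.HasPFTransitions) (A : Z.MeromorphicSection)
    {x : X} (hx : A.wronskianOrder x = ⊤) : ∀ᶠ y in 𝓝 x, A.wronskianOrder y = ⊤ := by
  rw [← nhdsNE_sup_pure, eventually_sup]
  refine ⟨?_, hx⟩
  have h0 : ∀ᶠ y in 𝓝[≠] x, A.wronskianNear x y = 0 :=
    ((chartAt ℂ x).tendsto_nhdsNE (mem_chart_source ℂ x)).eventually
      (meromorphicOrderAt_eq_top_iff.1 hx)
  -- Order `⊤` at `y` needs vanishing around `y`, not only at `y`.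
  have h1 := eventually_nhdsNE_eventually_nhds_iff.2 (h0.and (A.eventually_wronskianIn_eq hZ x))
  filter_upwards [h1] with y hy
  have hc : ContinuousAt (chartAt ℂ y).symm (chartAt ℂ y y) :=
    (chartAt ℂ y).continuousAt_symm (mem_chart_target ℂ y)
  have hl : (chartAt ℂ y).symm (chartAt ℂ y y) = y := (chartAt ℂ y).left_inv (mem_chart_source ℂ y)
  refine meromorphicOrderAt_eq_top_iff.2 (eventually_nhdsWithin_of_eventually_nhds ?_)
  filter_upwards [(chartAt ℂ y).open_target.mem_nhds (mem_chart_target ℂ y),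
    hc.eventually (hl.symm ▸ hy),
    hc.eventually ((Z.core.isOpen_baseSet (Z.core.indexAt y)).mem_nhds
      (hl.symm ▸ Z.core.mem_baseSet_at y :
        (chartAt ℂ y).symm (chartAt ℂ y y) ∈ Z.core.baseSet (Z.core.indexAt y)))]
    with t ht hty htb
  have := hty.2.2.2.2 _ htb y ((chartAt ℂ y).map_target ht)
  rwa [hty.1, mul_zero, (chartAt ℂ y).right_inv ht] at this

/-- The identity theorem: the points of infinite order form a clopen set. -/
lemma IsGeneric.wronskianOrder_ne_top [ConnectedSpace X] (hZ : Z.HasPFTransitions)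
    {A : Z.MeromorphicSection} (hA : A.IsGeneric) (x : X) : A.wronskianOrder x ≠ ⊤ := by
  have hclopen : IsClopen {y | A.wronskianOrder y = ⊤} := by
    refine ⟨⟨isOpen_iff_mem_nhds.2 fun y hy => ?_⟩, isOpen_iff_mem_nhds.2 fun y hy =>
      A.eventually_wronskianOrder_eq_top hZ hy⟩
    change ∀ᶠ z in 𝓝 y, A.wronskianOrder z ≠ ⊤
    rw [← nhdsNE_sup_pure, eventually_sup]
    refine ⟨(A.eventually_wronskianOrder_eq_zero hZ hy).mono fun z hz => ?_, hy⟩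
    simp [hz]
  rcases isClopen_iff.1 hclopen with h | h
  · exact fun hx => (h ▸ hx : x ∈ (∅ : Set X))
  · obtain ⟨y, hy⟩ := hA
    exact absurd (h.symm ▸ mem_univ y : y ∈ {y | A.wronskianOrder y = ⊤}) hy

/-- Neither the fallback `0` of `wronskianDivisor` nor the value of `untop₀` at `⊤` occurs for
generic sections. -/
lemma IsGeneric.coe_wronskianDivisor [ConnectedSpace X] (hZ : Z.HasPFTransitions)
    {A : Z.MeromorphicSection} (hA : A.IsGeneric) (x : X) :
    ((A.wronskianDivisor x : ℤ) : WithTop ℤ) = A.wronskianOrder x := by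
  have h : ∀ z : X, ∃ t ∈ 𝓝 z,
      (t ∩ Function.support fun x => (A.wronskianOrder x).untop₀).Finite := by
    intro z
    refine ⟨{y | y = z ∨ A.wronskianOrder y = 0}, ?_, (finite_singleton z).subset ?_⟩
    · change ∀ᶠ y in 𝓝 z, y = z ∨ A.wronskianOrder y = 0
      rw [← nhdsNE_sup_pure, eventually_sup]
      exact ⟨(A.eventually_wronskianOrder_eq_zero hZ (hA.wronskianOrder_ne_top hZ z)).mono
        fun y hy => Or.inr hy, Or.inl rfl⟩
    · rintro y ⟨hy | hy, hys⟩
      · exact hy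
      · simp [hy] at hys
  have : A.wronskianDivisor x = (A.wronskianOrder x).untop₀ := by
    rw [wronskianDivisor, dif_pos h]
    rfl
  rw [this]
  exact WithTop.coe_untop₀_of_ne_top (hA.wronskianOrder_ne_top hZ x)

end MeromorphicSection

end HolBundle

/-! ### The line bundle of the Wronskian divisor -/

section DivisorOrder

variable {X : Type u} [TopologicalSpace X] [ChartedSpace ℂ X]

lemma divisorEq_ne_zero_of_ne {D : Function.locallyFinsupp X ℤ} {p y : X}
    (hp : y ∈ divisorNhd D p) (h : y ≠ p) : divisorEq D p y ≠ 0 :=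
  zpow_ne_zero _ fun h0 => h ((chartAt ℂ p).injOn hp.1 (mem_chart_source ℂ p) (sub_eq_zero.1 h0))

/-- The point `p` must be excluded: for `p = q = y` and `D p ≠ 0` the quotient is `0 / 0 = 0`, not
`1`. -/
lemma divisorTrans_eq_div {D : Function.locallyFinsupp X ℤ} {p q y : X}
    (hp : y ∈ divisorNhd D p) (h : y ≠ p) :
    divisorTrans D p q y = divisorEq D q y / divisorEq D p y := by
  by_cases hpq : p = q
  · subst hpq
    simp [divisorTrans, div_self (divisorEq_ne_zero_of_ne hp h)]
  · simp [divisorTrans, hpq]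

lemma isOpen_divisorNhd (D : Function.locallyFinsupp X ℤ) (p : X) : IsOpen (divisorNhd D p) :=
  (chartAt ℂ p).open_source.inter isOpen_interior

lemma meromorphicOrderAt_divisorEq [T2Space X] [IsManifold 𝓘(ℂ) ω X]
    (D : Function.locallyFinsupp X ℤ) {p x : X} (hx : x ∈ divisorNhd D p) :
    MeromorphicAt (divisorEq D p ∘ (chartAt ℂ x).symm) (chartAt ℂ x x) ∧
      meromorphicOrderAt (divisorEq D p ∘ (chartAt ℂ x).symm) (chartAt ℂ x x) = D x := by
  by_cases h : x = p
  · subst h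
    have e : divisorEq D x ∘ (chartAt ℂ x).symm =ᶠ[𝓝[≠] (chartAt ℂ x x)]
        fun t => (t - chartAt ℂ x x) ^ D x := by
      filter_upwards [mem_nhdsWithin_of_mem_nhds
        ((chartAt ℂ x).open_target.mem_nhds (mem_chart_target ℂ x))] with t ht
      simp [divisorEq, (chartAt ℂ x).right_inv ht]
    have hm : MeromorphicAt (fun t => (t - chartAt ℂ x x) ^ D x) (chartAt ℂ x x) :=
      ((MeromorphicAt.id _).sub (MeromorphicAt.const _ _)).zpow (D x)
    refine ⟨hm.congr e.symm, ?_⟩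
    rw [meromorphicOrderAt_congr e]
    refine (meromorphicOrderAt_eq_int_iff hm).2 ⟨fun _ => 1, analyticAt_const, one_ne_zero, ?_⟩
    simp
  · have hD : D x = 0 := (interior_subset hx.2).resolve_left h
    have hc : ContMDiffAt 𝓘(ℂ) 𝓘(ℂ) ω (divisorEq D p) x :=
      (contMDiffOn_divisorEq D (Ne.symm h)).contMDiffAt
        (((isOpen_divisorNhd D p).inter (isOpen_divisorNhd D x)).mem_nhds
          ⟨hx, mem_divisorNhd D x⟩)
    have ha := (contMDiffAt_iff_analyticAt_comp_symm (IsManifold.chart_mem_maximalAtlas x)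
      (mem_chart_source ℂ x)).1 hc
    have hne : (divisorEq D p ∘ (chartAt ℂ x).symm) (chartAt ℂ x x) ≠ 0 := by
      simpa using divisorEq_ne_zero_of_ne hx h
    refine ⟨ha.meromorphicAt, ?_⟩
    rw [ha.meromorphicOrderAt_eq, ha.analyticOrderAt_eq_zero.2 hne, hD]
    rfl

end DivisorOrder

/-! ### Determinants of frame changes and the comparison isomorphism -/

namespace HolBundle

variable {X : Type u} [TopologicalSpace X] [ChartedSpace ℂ X] {n : ℕ}

lemma det_mul (f g : (Fin n → ℂ) →L[ℂ] (Fin n → ℂ)) : (f * g).det = f.det * g.det :=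
  LinearMap.det_comp _ _

lemma det_smul (c : ℂ) (f : (Fin n → ℂ) →L[ℂ] (Fin n → ℂ)) : (c • f).det = c ^ n * f.det := by
  simp [ContinuousLinearMap.det]

lemma contDiff_det {m : ℕ∞ω} :
    ContDiff ℂ m fun f : (Fin n → ℂ) →L[ℂ] (Fin n → ℂ) => f.det := by
  have : (fun f : (Fin n → ℂ) →L[ℂ] (Fin n → ℂ) => f.det) = fun f =>
      ∑ σ : Equiv.Perm (Fin n), ((Equiv.Perm.sign σ : ℤ) : ℂ) *
        ∏ k, f (Pi.single k 1) (σ k) := by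
    funext f
    rw [ContinuousLinearMap.det, ← LinearMap.det_toMatrix', Matrix.det_apply']
    simp [LinearMap.toMatrix'_apply]
  rw [this]
  refine ContDiff.sum fun σ _ => contDiff_const.mul (contDiff_prod fun k _ => ?_)
  exact contDiff_pi.1
    (ContinuousLinearMap.apply ℂ (Fin n → ℂ) (Pi.single k 1 : Fin n → ℂ)).contDiff (σ k)

lemma det_coordChange_self (V : HolBundle X (Fin n → ℂ)) {i : V.ι} {x : X}
    (hx : x ∈ V.core.baseSet i) : (V.core.coordChange i i x).det = 1 := by
  have : V.core.coordChange i i x = 1 := by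
    ext1 v
    simp [V.core.coordChange_self i x hx]
  rw [this]
  exact LinearMap.det_id

lemma trans_divisorBundle_tensor_pow [T2Space X] [IsManifold 𝓘(ℂ) ω X]
    (D : Function.locallyFinsupp X ℤ) (L : LineBundle X) (p p' : X) (l l' : L.ι) (y : X) :
    ((divisorBundle D).tensor (L.pow n)).trans (p, l) (p', l') y
      = L.trans l l' y ^ n * divisorTrans D p p' y := by
  simp [trans, tensor, pow, divisorBundle]

lemma trans_divisorBundle [T2Space X] [IsManifold 𝓘(ℂ) ω X]
    (D : Function.locallyFinsupp X ℤ) (q q' y : X) :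
    (divisorBundle D).trans q q' y = divisorTrans D q q' y := by
  simp [trans, divisorBundle]

variable [IsManifold 𝓘(ℂ) ω X] [T2Space X] [ConnectedSpace X]

/-- The Wronskian divided by a local equation of its divisor is holomorphic and nonvanishing. -/
lemma MeromorphicSection.IsGeneric.exists_wronskianNear_div {Z : HolBundle X (Fin n → ℂ)}
    (hZ : Z.HasPFTransitions) {A : Z.MeromorphicSection} (hA : A.IsGeneric) {p x : X}
    (hx : x ∈ divisorNhd A.wronskianDivisor p) : ∃ H : X → ℂ,
      ContMDiffAt 𝓘(ℂ) 𝓘(ℂ) ω H x ∧ H x ≠ 0 ∧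
      (fun y => A.wronskianNear x y / divisorEq A.wronskianDivisor p y) =ᶠ[𝓝[≠] x] H := by
  obtain ⟨hm, ho⟩ := meromorphicOrderAt_divisorEq A.wronskianDivisor hx
  have hw := (A.meromorphicAt_wronskianIn x).congr (A.wronskianNear_comp_symm x).symm
  refine exists_contMDiffAt_of_meromorphicOrderAt_eq_zero (hw.div hm) ?_
  have hwo : meromorphicOrderAt (A.wronskianNear x ∘ (chartAt ℂ x).symm) (chartAt ℂ x x)
      = (A.wronskianDivisor x : ℤ) := by
    rw [meromorphicOrderAt_congr (A.wronskianNear_comp_symm x), hA.coe_wronskianDivisor hZ]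
    rfl
  have := meromorphicOrderAt_div hw hm
  rw [hwo, ho] at this
  refine this.trans ?_
  norm_cast
  simp

/-- If `Y` and `Z ⊗ L` are isomorphic and `Z`, `Y` have projectively flat frames, then the divisors
of generic sections `A` of `Z` and `B` of `Y` satisfy `𝒪(div A) ⊗ Lⁿ ≅ 𝒪(div B)`. -/
lemma Iso.divisorBundle_tensor_pow {Z Y : HolBundle X (Fin n → ℂ)} (hZ : Z.HasPFTransitions)
    (hY : Y.HasPFTransitions) {L : LineBundle X} (h : (Z.tensor L).Iso Y)
    {A : Z.MeromorphicSection} (hA : A.IsGeneric) {B : Y.MeromorphicSection} (hB : B.IsGeneric) :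
    ((divisorBundle A.wronskianDivisor).tensor (L.pow n)).Iso
      (divisorBundle B.wronskianDivisor) := by
  -- Taking determinants in the compatibility relation turns the scalar transition of `L` into its
  -- `n`-th power.
  obtain ⟨g, hg, hgu, hdet⟩ : ∃ g : Z.ι → L.ι → Y.ι → X → ((Fin n → ℂ) →L[ℂ] (Fin n → ℂ)),
      (∀ i l j x, x ∈ Z.core.baseSet i → x ∈ L.core.baseSet l → x ∈ Y.core.baseSet j →
        ContMDiffAt 𝓘(ℂ) 𝓘(ℂ, (Fin n → ℂ) →L[ℂ] (Fin n → ℂ)) ω (g i l j) x) ∧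
      (∀ i l j x, x ∈ Z.core.baseSet i → x ∈ L.core.baseSet l → x ∈ Y.core.baseSet j →
        IsUnit (g i l j x)) ∧
      ∀ i i' l l' j j' x, x ∈ Z.core.baseSet i → x ∈ Z.core.baseSet i' →
        x ∈ L.core.baseSet l → x ∈ L.core.baseSet l' → x ∈ Y.core.baseSet j →
        x ∈ Y.core.baseSet j' →
        (Y.core.coordChange j j' x).det * (g i l j x).det = (g i' l' j' x).det *
          (L.trans l l' x ^ n * (Z.core.coordChange i i' x).det) := by
    obtain ⟨g, hg, hgu, hgc⟩ := h
    refine ⟨fun i l j => g (i, l) j, fun i l j x hi hl hj => (hg (i, l) j).contMDiffAt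
      ((((Z.tensor L).core.isOpen_baseSet (i, l)).inter
        (Y.core.isOpen_baseSet j)).mem_nhds ⟨⟨hi, hl⟩, hj⟩),
      fun i l j x hi hl hj => hgu (i, l) j x ⟨⟨hi, hl⟩, hj⟩, ?_⟩
    intro i i' l l' j j' x hi hi' hl hl' hj hj'
    rw [← det_smul, ← det_mul, ← det_mul]
    congr 1
    ext1 v
    exact hgc (i, l) (i', l') j j' x ⟨⟨⟨hi, hl⟩, hi', hl'⟩, hj, hj'⟩ v
  -- Frames and charts are those at `y`, so `G` needs no choices. Since `det g · w(A) / w(B)` does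
  -- not depend on them, they can be replaced near `x` by those at `x`, up to isolated points.
  let G : X → L.ι → X → X → ℂ := fun p l q y =>
    (g (Z.core.indexAt y) l (Y.core.indexAt y) y).det *
      (A.wronskianAt y / divisorEq A.wronskianDivisor p y) *
      (divisorEq B.wronskianDivisor q y / B.wronskianAt y)
  have hG : ∀ (p : X) l (q x : X), x ∈ divisorNhd A.wronskianDivisor p → x ∈ L.core.baseSet l →
      x ∈ divisorNhd B.wronskianDivisor q → ∃ H : X → ℂ,
        ContMDiffAt 𝓘(ℂ) 𝓘(ℂ) ω H x ∧ H x ≠ 0 ∧ G p l q =ᶠ[𝓝[≠] x] H := by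
    intro p l q x hxp hl hxq
    obtain ⟨HA, hHA, hHA0, hAe⟩ := hA.exists_wronskianNear_div hZ hxp
    obtain ⟨HB, hHB, hHB0, hBe⟩ := hB.exists_wronskianNear_div hY hxq
    have hxi := Z.core.mem_baseSet_at x
    have hxj := Y.core.mem_baseSet_at x
    refine ⟨fun y => (g (Z.core.indexAt x) l (Y.core.indexAt x) y).det * HA y * (HB y)⁻¹,
      ((contDiff_det.contDiffAt.comp_contMDiffAt (hg _ l _ x hxi hl hxj)).mul hHA).mul
        (hHB.inv₀ hHB0),
      mul_ne_zero (mul_ne_zero (isUnit_det (hgu _ l _ x hxi hl hxj)) hHA0) (inv_ne_zero hHB0), ?_⟩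
    filter_upwards [hAe, hBe, A.eventually_wronskianIn_eq hZ x, B.eventually_wronskianIn_eq hY x,
      mem_nhdsWithin_of_mem_nhds ((L.core.isOpen_baseSet l).mem_nhds hl)]
      with y hAy hBy ⟨hyi, hyc, _, hAl⟩ ⟨hyj, _, _, hBl⟩ hyl
    have hyi' := Z.core.mem_baseSet_at y
    have hyj' := Y.core.mem_baseSet_at y
    have hyc' := mem_chart_source ℂ y
    have hd := pow_ne_zero (∑ k : Fin n, (k : ℕ)) (deriv_chartChange_ne_zero
      (IsManifold.chart_mem_maximalAtlas (I := 𝓘(ℂ)) (n := ω) x)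
      (IsManifold.chart_mem_maximalAtlas y) hyc hyc')
    have hYd := isUnit_det (Y.isUnit_coordChange ⟨hyj, hyj'⟩)
    have hgd := hdet _ _ l l _ _ y hyi hyi' hyl hyl hyj hyj'
    rw [L.trans_self l hyl, one_pow, one_mul, mul_comm, ← eq_div_iff hYd] at hgd
    simp only [G, MeromorphicSection.wronskianAt]
    rw [hAl _ hyi' y hyc', hBl _ hyj' y hyc', ← hAy, ← hBy, hgd, inv_div]
    -- Both Wronskians carry the same power of the coordinate derivative, since the ranks agree; it
    -- cancels.
    generalize deriv (chartAt ℂ x ∘ (chartAt ℂ y).symm) (chartAt ℂ y y) ^ _ = d at hd ⊢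
    -- If `w(B)` vanishes at `y`, both sides are `0` by the convention on division by zero.
    by_cases hb : B.wronskianNear x y = 0
    · simp [hb]
    · field_simp
  have hc : ∀ (p p' : X) l l' (q q' x : X), x ∈ divisorNhd A.wronskianDivisor p →
      x ∈ divisorNhd A.wronskianDivisor p' → x ∈ L.core.baseSet l → x ∈ L.core.baseSet l' →
      x ∈ divisorNhd B.wronskianDivisor q → ∀ᶠ y in 𝓝[≠] x,
        divisorTrans B.wronskianDivisor q q' y * G p l q y =
          G p' l' q' y * (L.trans l l' y ^ n * divisorTrans A.wronskianDivisor p p' y) := by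
    intro p p' l l' q q' x hp hp' hl hl' hq
    have hne : ∀ r : X, ∀ᶠ y in 𝓝[≠] x, y ≠ r := fun r =>
      (nhdsNE_le_cofinite x) (finite_singleton r).compl_mem_cofinite
    filter_upwards [hne p, hne p', hne q,
      mem_nhdsWithin_of_mem_nhds ((isOpen_divisorNhd A.wronskianDivisor p).mem_nhds hp),
      mem_nhdsWithin_of_mem_nhds ((isOpen_divisorNhd A.wronskianDivisor p').mem_nhds hp'),
      mem_nhdsWithin_of_mem_nhds ((isOpen_divisorNhd B.wronskianDivisor q).mem_nhds hq),
      mem_nhdsWithin_of_mem_nhds ((L.core.isOpen_baseSet l).mem_nhds hl),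
      mem_nhdsWithin_of_mem_nhds ((L.core.isOpen_baseSet l').mem_nhds hl')]
      with y np np' nq yp yp' yq yl yl'
    have hyi := Z.core.mem_baseSet_at y
    have hyj := Y.core.mem_baseSet_at y
    have hgd := hdet _ _ l l' _ _ y hyi hyi yl yl' hyj hyj
    -- Only the frame of `L` changes here, so the relation reduces to the factor `L.trans l l' y ^
    -- n`.
    rw [det_coordChange_self Z hyi, det_coordChange_self Y hyj, one_mul, mul_one] at hgd
    have h₁ := divisorEq_ne_zero_of_ne yp np
    have h₂ := divisorEq_ne_zero_of_ne yp' np'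
    have h₃ := divisorEq_ne_zero_of_ne yq nq
    simp only [G]
    rw [divisorTrans_eq_div yq nq, divisorTrans_eq_div yp np, hgd]
    field_simp
  refine Iso.of_eventually (P := (divisorBundle A.wronskianDivisor).tensor (L.pow n))
    (Q := divisorBundle B.wronskianDivisor) (fun p q => G p.1 p.2 q)
    (fun p q x hx => hG p.1 p.2 q x hx.1.1 hx.1.2 hx.2) fun p p' q q' x hx => ?_
  have h₀ := hc p.1 p'.1 p.2 p'.2 q q' x hx.1.1.1 hx.1.2.1 hx.1.1.2 hx.1.2.2 hx.2.1
  refine h₀.mono fun y hy => ?_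
  refine (congrArg (· * _) (trans_divisorBundle (X := X) _ q q' y)).trans (hy.trans ?_)
  exact congrArg (_ * ·) (trans_divisorBundle_tensor_pow (X := X) _ L p.1 p'.1 p.2 p'.2 y).symm

end HolBundle

/-! ### Products of sections and the main theorem -/

namespace HolBundle

variable {X : Type u} [TopologicalSpace X] [ChartedSpace ℂ X] {n : ℕ}

namespace MeromorphicSection

variable [IsManifold 𝓘(ℂ) ω X] {V : HolBundle X (Fin n → ℂ)} {L : LineBundle X}

lemma wronskianIn_mul (A : V.MeromorphicSection) (f : L.MeromorphicSection)
    {e : OpenPartialHomeomorph X ℂ} (he : e ∈ IsManifold.maximalAtlas 𝓘(ℂ) ω X) {i : V.ι}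
    {k : L.ι} {x : X} (hx : x ∈ e.source ∩ (V.core.baseSet i ∩ L.core.baseSet k)) :
    (f.mul A).wronskianIn e (i, k) =ᶠ[𝓝[≠] (e x)]
      fun z => f.loc k (e.symm z) ^ n * A.wronskianIn e i z := by
  have hA := A.eventually_contMDiffAt hx.2.1
  have hf := (f.meromorphic k x hx.2.2).eventually_contMDiffAt
    (IsManifold.chart_mem_maximalAtlas x) (mem_chart_source ℂ x)
  filter_upwards [(e.tendsto_symm_nhdsNE hx.1).eventually (hA.and hf),
    mem_nhdsWithin_of_mem_nhds (e.open_target.mem_nhds (e.map_source hx.1))] with z hz hzt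
  have h₁ := (contMDiffAt_iff_analyticAt_comp_symm he (e.map_target hzt)).1 hz.1
  have h₂ := (contMDiffAt_iff_analyticAt_comp_symm he (e.map_target hzt)).1 hz.2
  rw [e.right_inv hzt] at h₁ h₂
  have h := wronskian_mul_comp (a := A.loc i ∘ e.symm) analyticAt_id h₂ h₁
  simpa using! h

/-- `w(A)` must be nonzero near the same point as `f`, so finite order is required everywhere. -/
lemma isGeneric_mul {A : V.MeromorphicSection} (hV : ∀ x, A.wronskianOrder x ≠ ⊤)
    {f : L.MeromorphicSection} (hf : f.IsNonzero) : (f.mul A).IsGeneric := by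
  obtain ⟨x, hx⟩ := hf
  refine ⟨x, ?_⟩
  have hw := (meromorphicOrderAt_ne_top_iff_eventually_ne_zero
    (A.meromorphicAt_wronskianIn x)).1 (hV x)
  have hf := (meromorphicOrderAt_ne_top_iff_eventually_ne_zero
    (f.meromorphic _ x (L.core.mem_baseSet_at x))).1 hx
  refine (meromorphicOrderAt_ne_top_iff_eventually_ne_zero
    ((f.mul A).meromorphicAt_wronskianIn x)).2 ?_
  have h := wronskianIn_mul A f (IsManifold.chart_mem_maximalAtlas x)
    ⟨mem_chart_source ℂ x, V.core.mem_baseSet_at x, L.core.mem_baseSet_at x⟩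
  filter_upwards [hw, hf, h] with z h₁ h₂ h₃
  exact h₃.trans_ne (mul_ne_zero (pow_ne_zero _ h₂) h₁)

end MeromorphicSection

end HolBundle

theorem mainTheorem5 {X : Type u} [TopologicalSpace X] [T2Space X] [ConnectedSpace X]
    [ChartedSpace ℂ X] [IsManifold 𝓘(ℂ) ω X] {n : ℕ}
    (V : HolBundle X (Fin n → ℂ)) (hV : V.IsProjectivelyFlat) (L : LineBundle X) :
    (V.tensor L).IsProjectivelyFlat ∧
    (∀ M N : LineBundle X, V.IsWronskianLineBundle M → (V.tensor L).IsWronskianLineBundle N →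
      N.Iso (M.tensor (L.pow n))) ∧
    (∀ M : LineBundle X, V.IsWronskianLineBundle M →
      (∃ f : L.MeromorphicSection, f.IsNonzero) →
        (V.tensor L).IsWronskianLineBundle (M.tensor (L.pow n))) ∧
    (∀ (A : V.MeromorphicSection) (f : L.MeromorphicSection),
      ∀ e ∈ IsManifold.maximalAtlas 𝓘(ℂ) ω X, ∀ (i : V.ι) (k : L.ι),
        ∀ x ∈ e.source ∩ (V.core.baseSet i ∩ L.core.baseSet k),
          (f.mul A).wronskianIn e (i, k) =ᶠ[𝓝[≠] (e x)]
            fun z => f.loc k (e.symm z) ^ n * A.wronskianIn e i z) := by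
  refine ⟨hV.tensor L, ?_, ?_, fun A f e he i k x hx =>
    HolBundle.MeromorphicSection.wronskianIn_mul A f he hx⟩
  · rintro M N ⟨Z, hZ, hZV, A, hA, hM⟩ ⟨Y, hY, hYV, B, hB, hN⟩
    -- The comparison is applied to `Z ⊗ L ≅ V ⊗ L ≅ Y`.
    exact hN.trans (((hM.tensor (L.pow n)).trans
      (((hZV.tensor L).trans hYV.symm).divisorBundle_tensor_pow hZ hY hA hB)).symm)
  · rintro M ⟨Z, hZ, hZV, A, hA, hM⟩ ⟨f, hf⟩
    have hfA : (f.mul A).IsGeneric :=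
      HolBundle.MeromorphicSection.isGeneric_mul (hA.wronskianOrder_ne_top hZ) hf
    -- Here `Y = Z ⊗ L` with the identity isomorphism, and `B = fA`.
    exact ⟨Z.tensor L, hZ.tensor L, hZV.tensor L, f.mul A, hfA, (hM.tensor (L.pow n)).trans
      ((HolBundle.Iso.refl (Z.tensor L)).divisorBundle_tensor_pow hZ (hZ.tensor L) hA hfA)⟩
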